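/- For a metric space $X$, let $\dim_H X$ denote its Hausdorff dimension, with the convention $\dim_H\emptyset=-1$. The $n$th inductive topological Hausdorff dimension is defined by $\dim_{t^nH}\emptyset=-1$ for all $n\in\mathbb N=\{0,1,2,\dots\}$ and, for $X\neq\emptyset$, by $\dim_{t^0H}X=\dim_H X$ and, for $n\ge 1$, $$\dim_{t^nH}X=\inf\{d : X \text{ has a basis } \mathcal U \text{ of open sets such that } \dim_{t^{n-1}H}\partial U\le d-1 \text{ for every } U\in\mathcal U\},$$ where $d=\infty$ is allowed with $\infty-1=\infty$, and $\partial U$ is the boundary of $U$ with the subspace metric. The product of two metric spaces carries the metric $\sqrt{d_X^2+d_Y^2}$, the cube $[0,1]^k$ carries the Euclidean metric, and $[0,1]^0=\{0\}$. Let $X$ be a non-empty separable metric space and let $n,k\in\mathbb N$ with $n\le k$. Then $$\dim_{t^nH}\left(X\times[0,1]^k\right)=\dim_H\left(X\times[0,1]^k\right)=\dim_H X+k,$$ where the values may be $\infty$. -/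

import Mathlib

open Classical in
/-- Hausdorff dimension of a metric space, with the convention that the empty space has
dimension `-1`. -/
noncomputable def hausdorffDim (X : Type*) [MetricSpace X] : EReal :=
  if IsEmpty X then -1 else ((dimH (Set.univ : Set X) : ENNReal) : EReal)

open Classical in
/-- The `n`th inductive topological Hausdorff dimension of a metric space; boundaries carry the
subspace metric. In `EReal` one has `⊤ - 1 = ⊤`, so `d = ⊤` always belongs to the set below. -/
noncomputable def inductiveTopHausdorffDim : ℕ → (X : Type*) → [MetricSpace X] → EReal
  | 0, X, _ => hausdorffDim X
  | n + 1, X, _ =>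
    if IsEmpty X then -1
    else sInf {d : EReal | ∃ 𝒰 : Set (Set X), TopologicalSpace.IsTopologicalBasis 𝒰 ∧
      ∀ U ∈ 𝒰, inductiveTopHausdorffDim n (frontier U) ≤ d - 1}

/-- The cube `[0,1]^k` with the Euclidean metric (a single point for `k = 0`). -/
abbrev UnitCube (k : ℕ) : Type := PiLp 2 (fun _ : Fin k => Set.Icc (0 : ℝ) 1)

/-- The `l²`-product of two metric spaces. -/
abbrev L2Prod (X Y : Type*) : Type _ := WithLp 2 (X × Y)

/-!
Suppose that `dim_{t^kH} (X × [0,1]^k) < d`. Passing `k` times to the boundaries of the members of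
countable bases decomposes the product into a set `A` with `dim_H A + k ≤ d` and `k` sets of large
inductive dimension at most `0`. Two opposite faces of the cube can be separated by disjoint open
sets that cover a given one of these `k` sets. By Kuhn's cubical lemma, a discrete form of the
theorem on partitions of the cube, the complements of the `k` pairs of open sets have a common point
in each fibre `{x} × [0,1]^k`. These points lie in `A`, so `A` projects onto `X` by a `1`-Lipschitz
map, and `dim_H X + k ≤ d`.

Conversely, almost every fibre of a Lipschitz function loses one dimension; applied to the spheres
around a point this gives `dim_{t^(n+1)H} ≤ dim_{t^nH}`. Finally,
`dim_H (X × [0,1]^k) ≤ dim_H X + k`, because the cube has covers by `O(r^(-k))` sets of diameter at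
most `r`.
-/

open Set Topology TopologicalSpace MeasureTheory Measure Filter
open scoped ENNReal NNReal

universe u

/-! ### Spaces of large inductive dimension zero -/

/-- The property `Ind Y ≤ 0` of the large inductive dimension: every closed set has arbitrarily
small clopen neighbourhoods. -/
def IndNonpos (Y : Type*) [TopologicalSpace Y] : Prop :=
  ∀ ⦃E O : Set Y⦄, IsClosed E → IsOpen O → E ⊆ O → ∃ W, IsClopen W ∧ E ⊆ W ∧ W ⊆ O

theorem indNonpos_of_countable_isClopen_basis {Y : Type*} [TopologicalSpace Y] {𝒱 : Set (Set Y)}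
    (h𝒱 : IsTopologicalBasis 𝒱) (hcount : 𝒱.Countable) (hclopen : ∀ B ∈ 𝒱, IsClopen B) :
    IndNonpos Y := by
  intro E O hE hO hEO
  obtain ⟨B, hB⟩ := ((hcount.mono (sep_subset 𝒱 fun B => B ⊆ O ∨ B ⊆ Eᶜ)).insert ∅).exists_eq_range
    (insert_nonempty _ _)
  have hBmem : ∀ n, B n = ∅ ∨ B n ∈ 𝒱 ∧ (B n ⊆ O ∨ B n ⊆ Eᶜ) := fun n =>
    hB.symm.subset (mem_range_self n)
  have hBclopen : ∀ n, IsClopen (B n) := fun n =>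
    (hBmem n).elim (fun h => h ▸ isClopen_empty) fun h => hclopen _ h.1
  have hBsub : ∀ n, B n ⊆ O ∨ B n ⊆ Eᶜ := fun n =>
    (hBmem n).elim (fun h => Or.inl (h ▸ empty_subset O)) And.right
  have hdisj_open : ∀ n, IsOpen (disjointed B n) := fun n =>
    (disjointedRec (fun _ _ h => h.diff (hBclopen _)) (hBclopen n)).isOpen
  have hcover : ∀ z, ∃ n, z ∈ disjointed B n := by
    intro z
    suffices ∃ n, z ∈ B n by simpa only [← mem_iUnion, iUnion_disjointed] using this
    have hsmall : ∀ O' : Set Y, IsOpen O' → z ∈ O' → (O' ⊆ O ∨ O' ⊆ Eᶜ) → ∃ n, z ∈ B n := by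
      intro O' hO' hz hsub
      obtain ⟨D, hD, hzD, hDO'⟩ := h𝒱.exists_subset_of_mem_open hz hO'
      obtain ⟨n, rfl⟩ := hB.subset (Or.inr ⟨hD, hsub.imp hDO'.trans hDO'.trans⟩)
      exact ⟨n, hzD⟩
    by_cases hz : z ∈ E
    · exact hsmall O hO (hEO hz) (Or.inl Subset.rfl)
    · exact hsmall Eᶜ hE.isOpen_compl hz (Or.inr Subset.rfl)
  let W : Set Y := ⋃ n ∈ {n | B n ⊆ O}, disjointed B n
  have hcompl : Wᶜ = ⋃ n ∈ {n | ¬ B n ⊆ O}, disjointed B n := by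
    ext z
    obtain ⟨n, hn⟩ := hcover z
    have huniq : ∀ m, z ∈ disjointed B m → m = n := fun m hm => by
      by_contra hmn
      exact disjoint_left.1 (disjoint_disjointed B hmn) hm hn
    simp only [W, mem_compl_iff, mem_iUnion, mem_ofPred_eq, exists_prop]
    grind
  refine ⟨W, ⟨⟨?_⟩, isOpen_biUnion fun n _ => hdisj_open n⟩, fun z hz => ?_,
    iUnion₂_subset fun n hn => (disjointed_subset B n).trans hn⟩
  · exact hcompl ▸ isOpen_biUnion fun n _ => hdisj_open n
  · obtain ⟨n, hn⟩ := hcover z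
    exact mem_iUnion₂.2 ⟨n, (hBsub n).resolve_right fun h => h (disjointed_subset B n hn) hz, hn⟩

theorem indNonpos_of_isInducing_of_notMem_frontier {Y W : Type*} [TopologicalSpace Y]
    [TopologicalSpace W] {g : W → Y} (hg : IsInducing g) {𝒱 : Set (Set Y)}
    (h𝒱 : IsTopologicalBasis 𝒱) (hcount : 𝒱.Countable)
    (hfr : ∀ B ∈ 𝒱, ∀ w, g w ∉ frontier B) : IndNonpos W := by
  refine indNonpos_of_countable_isClopen_basis (h𝒱.isInducing hg) (hcount.image _) ?_
  rintro _ ⟨B, hB, rfl⟩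
  rw [isClopen_iff_frontier_eq_empty]
  exact eq_empty_of_forall_notMem fun w hw =>
    hfr B hB w (hg.continuous.frontier_preimage_subset B hw)

theorem exists_isOpen_thickening_of_indNonpos {Y : Type*} [TopologicalSpace Y] [NormalSpace Y]
    {K : Set Y} (hK : IsClosed K) (hKdim : IndNonpos K) {u v : Set Y} (hv : IsOpen v)
    (huv : closure u ⊆ v) :
    ∃ u' v' : Set Y, IsOpen u' ∧ IsOpen v' ∧ closure u' ⊆ v' ∧ closure u ⊆ u' ∧ closure v' ⊆ v ∧
      K ∩ v' ⊆ u' := by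
  obtain ⟨W, hW, huW, hWv⟩ := hKdim (isClosed_closure.preimage continuous_subtype_val)
    (hv.preimage continuous_subtype_val) (preimage_mono huv)
  have hin : IsClosed (Subtype.val '' W) :=
    hK.isClosedEmbedding_subtypeVal.isClosedMap _ hW.isClosed
  have hout : IsClosed (Subtype.val '' Wᶜ) :=
    hK.isClosedEmbedding_subtypeVal.isClosedMap _ hW.compl.isClosed
  have hsub : closure u ∪ Subtype.val '' W ⊆ v \ Subtype.val '' Wᶜ := by
    rintro z (hz | ⟨z, hz, rfl⟩)
    · refine ⟨huv hz, ?_⟩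
      rintro ⟨w, hw, rfl⟩
      exact hw (huW hz)
    · refine ⟨hWv hz, ?_⟩
      rintro ⟨w, hw, hwz⟩
      exact hw (Subtype.ext hwz ▸ hz)
  obtain ⟨u', hu', hu'sub, hu'v⟩ := normal_exists_closure_subset (isClosed_closure.union hin)
    (hv.sdiff hout) hsub
  obtain ⟨v', hv', hu'v', hv'v⟩ := normal_exists_closure_subset isClosed_closure
    (hv.sdiff hout) hu'v
  refine ⟨u', v', hu', hv', hu'v', subset_union_left.trans hu'sub, hv'v.trans sdiff_subset, ?_⟩
  rintro z ⟨hzK, hzv'⟩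
  refine hu'sub (Or.inr ⟨⟨z, hzK⟩, ?_, rfl⟩)
  by_contra hzW
  exact (hv'v (subset_closure hzv')).2 ⟨_, hzW, rfl⟩

/-- The countable closed sum theorem in dimension zero: an increasing sequence `u` of open sets and
a decreasing sequence `v` of open sets around it are squeezed together on each member of the cover
in turn. -/
theorem indNonpos_of_iUnion_isClosed {Y ι : Type*} [TopologicalSpace Y] [NormalSpace Y]
    [Countable ι] {K : ι → Set Y} (hK : ∀ i, IsClosed (K i)) (hcover : ⋃ i, K i = univ)
    (hdim : ∀ i, IndNonpos (K i)) : IndNonpos Y := by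
  intro E O hE hO hEO
  rcases isEmpty_or_nonempty ι with hι | hι
  · rw [iUnion_of_empty] at hcover
    exact ⟨∅, isClopen_empty, fun z _ => hcover.symm.subset (mem_univ z), empty_subset O⟩
  obtain ⟨e, he⟩ := exists_surjective_nat ι
  let T := {p : Set Y × Set Y // IsOpen p.1 ∧ IsOpen p.2 ∧ closure p.1 ⊆ p.2}
  have hstep : ∀ (n : ℕ) (p : T), ∃ q : T, closure p.1.1 ⊆ q.1.1 ∧ closure q.1.2 ⊆ p.1.2 ∧
      K (e n) ∩ q.1.2 ⊆ q.1.1 := by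
    rintro n ⟨⟨u, v⟩, -, hv, huv⟩
    obtain ⟨u', v', hu', hv', hu'v', h⟩ :=
      exists_isOpen_thickening_of_indNonpos (hK (e n)) (hdim (e n)) hv huv
    exact ⟨⟨(u', v'), hu', hv', hu'v'⟩, h⟩
  choose next hnext_u hnext_v hnext_K using hstep
  obtain ⟨u₀, hu₀, hEu₀, hu₀O⟩ := normal_exists_closure_subset hE hO hEO
  let s : ℕ → T := fun n => Nat.rec ⟨(u₀, O), hu₀, hO, hu₀O⟩ next n
  let u : ℕ → Set Y := fun n => (s n).1.1
  let v : ℕ → Set Y := fun n => (s n).1.2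
  have hu_mono : Monotone u :=
    monotone_nat_of_le_succ fun n => subset_closure.trans (hnext_u n (s n))
  have hv_anti : Antitone v :=
    antitone_nat_of_succ_le fun n => subset_closure.trans (hnext_v n (s n))
  have huv : ∀ m n, u m ⊆ v n := fun m n =>
    (hu_mono (le_max_left m n)).trans <| subset_closure.trans <|
      (s (max m n)).2.2.2.trans (hv_anti (le_max_right m n))
  have hlimit : ⋃ n, u n = ⋂ n, closure (v n) := by
    refine Subset.antisymm (iUnion_subset fun m => subset_iInter fun n =>
      (huv m n).trans subset_closure) fun z hz => ?_
    obtain ⟨i, hi⟩ := mem_iUnion.1 (hcover.symm.subset (mem_univ z))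
    obtain ⟨n, rfl⟩ := he i
    have hzv : z ∈ v (n + 1) := hnext_v (n + 1) (s (n + 1)) (mem_iInter.1 hz (n + 2))
    exact mem_iUnion.2 ⟨n + 1, hnext_K n (s n) ⟨hi, hzv⟩⟩
  exact ⟨⋃ n, u n, ⟨hlimit ▸ isClosed_iInter fun n => isClosed_closure,
    isOpen_iUnion fun n => (s n).2.1⟩, hEu₀.trans (subset_iUnion u 0),
    iUnion_subset fun n => huv n 0⟩

/-- Both sets are first enlarged by their part of the zero-dimensional set; the two enlargements
are still separated, and complete normality applies to them. -/
theorem exists_isOpen_separation_of_indNonpos {Z : Type*} [TopologicalSpace Z]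
    [CompletelyNormalSpace Z] {C A B : Set Z} (hC : IndNonpos C) (hA : IsClosed A)
    (hB : IsClosed B) (hAB : Disjoint A B) :
    ∃ U V : Set Z, IsOpen U ∧ IsOpen V ∧ Disjoint U V ∧ A ⊆ U ∧ B ⊆ V ∧ C ⊆ U ∪ V := by
  obtain ⟨O, hO, hAO, hOB⟩ := normal_exists_closure_subset hA hB.isOpen_compl
    (subset_compl_iff_disjoint_right.2 hAB)
  obtain ⟨P, hP, hOP, hPB⟩ := normal_exists_closure_subset isClosed_closure hB.isOpen_compl hOB
  obtain ⟨W, hW, hOW, hWP⟩ := hC (isClosed_closure.preimage continuous_subtype_val)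
    (hP.preimage continuous_subtype_val) (preimage_mono hOP)
  have hclosure : ∀ {M : Set C}, IsClosed M →
      Disjoint (closure (Subtype.val '' M)) (Subtype.val '' Mᶜ) := by
    intro M hM
    rw [disjoint_right]
    rintro _ ⟨z, hzM, rfl⟩ hz
    exact hzM (hM.closure_subset (closure_subtype.2 hz))
  have hOW' : Disjoint O (Subtype.val '' Wᶜ) := by
    rw [disjoint_right]
    rintro _ ⟨z, hzW, rfl⟩ hz
    exact hzW (hOW (subset_closure hz))
  have hWB : Disjoint (closure (Subtype.val '' W)) B :=
    subset_compl_iff_disjoint_right.1 ((closure_mono (image_subset_iff.2 hWP)).trans hPB)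
  have hleft : Disjoint (closure (A ∪ Subtype.val '' W)) (B ∪ Subtype.val '' Wᶜ) := by
    rw [closure_union, hA.closure_eq, disjoint_union_left, disjoint_union_right,
      disjoint_union_right]
    exact ⟨⟨hAB, hOW'.mono_left hAO⟩, hWB, hclosure hW.isClosed⟩
  have hright : Disjoint (A ∪ Subtype.val '' W) (closure (B ∪ Subtype.val '' Wᶜ)) := by
    rw [closure_union, hB.closure_eq, disjoint_union_left, disjoint_union_right,
      disjoint_union_right]
    refine ⟨⟨hAB, (hOW'.closure_right hO).mono_left hAO⟩, hWB.mono_left subset_closure, ?_⟩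
    simpa only [compl_compl] using (hclosure hW.compl.isClosed).symm
  obtain ⟨U, V, hU, hV, hSU, hTV, hUV⟩ :=
    separatedNhds_iff_disjoint.2 (completely_normal hleft hright)
  refine ⟨U, V, hU, hV, hUV, subset_union_left.trans hSU, subset_union_left.trans hTV, ?_⟩
  intro z hz
  by_cases hzW : (⟨z, hz⟩ : C) ∈ W
  · exact Or.inl (hSU (Or.inr ⟨_, hzW, rfl⟩))
  · exact Or.inr (hTV (Or.inr ⟨_, hzW, rfl⟩))

/-! ### Decomposition by iterated boundaries -/

theorem hausdorffDim_of_nonempty (X : Type*) [MetricSpace X] [Nonempty X] :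
    hausdorffDim X = ((dimH (univ : Set X) : ℝ≥0∞) : EReal) :=
  if_neg (not_isEmpty_iff.2 inferInstance)

theorem exists_countable_basis_of_inductiveTopHausdorffDim_lt {Y : Type*} [MetricSpace Y]
    [SecondCountableTopology Y] {n : ℕ} {d : EReal}
    (h : inductiveTopHausdorffDim (n + 1) Y < d) :
    ∃ 𝒱 : Set (Set Y), IsTopologicalBasis 𝒱 ∧ 𝒱.Countable ∧
      ∀ B ∈ 𝒱, inductiveTopHausdorffDim n (frontier B) < d - 1 := by
  rcases isEmpty_or_nonempty Y with hY | hY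
  · exact ⟨∅, isTopologicalBasis_of_isOpen_of_nhds (fun _ => False.elim) (fun y => hY.elim y),
      countable_empty, fun _ => False.elim⟩
  rw [inductiveTopHausdorffDim, if_neg (not_isEmpty_iff.2 hY), sInf_lt_iff] at h
  obtain ⟨e, ⟨𝒰, h𝒰, hfrontier⟩, hed⟩ := h
  obtain ⟨𝒱, h𝒱𝒰, hcount, h𝒱⟩ := h𝒰.exists_countable
  exact ⟨𝒱, h𝒱, hcount, fun B hB => (hfrontier B (h𝒱𝒰 hB)).trans_lt
    (EReal.sub_lt_sub_of_lt_of_le hed le_rfl (EReal.coe_ne_bot 1) (EReal.coe_ne_top 1))⟩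

theorem indNonpos_iUnion_range_sdiff_frontier {Z ι : Type*} [TopologicalSpace Z]
    [CompletelyNormalSpace Z] [Countable ι] {Y : ι → Type*} [∀ j, TopologicalSpace (Y j)]
    {f : ∀ j, Y j → Z} (hf : ∀ j, IsClosedEmbedding (f j)) {𝒱 : ∀ j, Set (Set (Y j))}
    (h𝒱 : ∀ j, IsTopologicalBasis (𝒱 j)) (hcount : ∀ j, (𝒱 j).Countable) :
    IndNonpos ↥((⋃ j, range (f j)) \ ⋃ j, ⋃ B ∈ 𝒱 j, f j '' frontier B) := by
  let D : Set Z := (⋃ j, range (f j)) \ ⋃ j, ⋃ B ∈ 𝒱 j, f j '' frontier B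
  let K : ι → Set D := fun j => Subtype.val ⁻¹' range (f j)
  refine indNonpos_of_iUnion_isClosed (K := K)
    (fun j => (hf j).isClosed_range.preimage continuous_subtype_val)
    (eq_univ_of_forall fun z => ?_) fun j => ?_
  · simpa only [K, mem_iUnion, mem_preimage] using z.2.1
  · choose g hg using fun w : K j => w.2
    have hg_ind : IsInducing g := by
      rw [← (hf j).isInducing.of_comp_iff,
        show f j ∘ g = (Subtype.val : D → Z) ∘ Subtype.val from funext hg]
      exact IsInducing.subtypeVal.comp IsInducing.subtypeVal
    refine indNonpos_of_isInducing_of_notMem_frontier hg_ind (h𝒱 j) (hcount j) fun B hB w hw => ?_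
    exact w.1.2.2 (mem_iUnion.2 ⟨j, mem_iUnion₂.2 ⟨B, hB, g w, hw, hg w⟩⟩)

theorem dimH_iUnion_range_le_of_hausdorffDim_le {Z ι : Type*} [MetricSpace Z] [Countable ι]
    {Y : ι → Type*} [∀ j, MetricSpace (Y j)] {f : ∀ j, Y j → Z} (hf : ∀ j, LipschitzWith 1 (f j))
    {d : EReal} (hd : ∀ j, hausdorffDim (Y j) ≤ d) (hne : (⋃ j, range (f j)).Nonempty) :
    ((dimH (⋃ j, range (f j)) : ℝ≥0∞) : EReal) ≤ d := by
  obtain ⟨_, y⟩ := hne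
  obtain ⟨j₀, y₀, -⟩ := mem_iUnion.1 y
  have hdim : ∀ j, Nonempty (Y j) → ((dimH (univ : Set (Y j)) : ℝ≥0∞) : EReal) ≤ d := fun j _ =>
    (hausdorffDim_of_nonempty (Y j)).ge.trans (hd j)
  have hd₀ : 0 ≤ d := (EReal.coe_ennreal_nonneg _).trans (hdim j₀ ⟨y₀⟩)
  rw [← EReal.coe_toENNReal hd₀] at hdim ⊢
  rw [EReal.coe_ennreal_le_coe_ennreal_iff, dimH_iUnion]
  refine iSup_le fun j => ?_
  rcases isEmpty_or_nonempty (Y j) with hY | hY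
  · simp only [range_eq_empty, dimH_empty, zero_le]
  · exact (hf j).dimH_range_le.trans (EReal.coe_ennreal_le_coe_ennreal_iff.1 (hdim j hY))

/-- A whole family of spaces is treated at once, so that the sum theorem merges the zero-dimensional
sets which its members lose on passing to boundaries into a single one. -/
theorem exists_indNonpos_decomposition {Z : Type*} [MetricSpace Z] [SeparableSpace Z] (n : ℕ)
    {ι : Type u} [Countable ι] {Y : ι → Type u} [∀ j, MetricSpace (Y j)] {f : ∀ j, Y j → Z}
    (hf : ∀ j, IsClosedEmbedding (f j)) (hlip : ∀ j, LipschitzWith 1 (f j)) {d : EReal}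
    (hd : ∀ j, inductiveTopHausdorffDim n (Y j) < d) :
    ∃ (A : Set Z) (C : Fin n → Set Z), (∀ i, IndNonpos (C i)) ∧
      ⋃ j, range (f j) ⊆ A ∪ ⋃ i, C i ∧
      (A.Nonempty → ((dimH A : ℝ≥0∞) : EReal) + n ≤ d) := by
  have : SecondCountableTopology Z := UniformSpace.secondCountable_of_separable Z
  induction n generalizing ι Y d with
  | zero =>
    refine ⟨⋃ j, range (f j), Fin.elim0, fun i => i.elim0, subset_union_left, fun hne => ?_⟩
    simpa only [Nat.cast_zero, add_zero] using
      dimH_iUnion_range_le_of_hausdorffDim_le hlip (fun j => (hd j).le) hne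
  | succ n ih =>
    have hsc : ∀ j, SecondCountableTopology (Y j) := fun j =>
      (hf j).isInducing.secondCountableTopology
    choose 𝒱 h𝒱 hcount hfrontier using fun j =>
      exists_countable_basis_of_inductiveTopHausdorffDim_lt (hd j)
    have : ∀ j, Countable (𝒱 j) := fun j => (hcount j).to_subtype
    obtain ⟨A, C, hC, hAC, hA⟩ := ih (ι := Σ j, 𝒱 j) (Y := fun p => frontier p.2.1)
      (f := fun p => f p.1 ∘ Subtype.val)
      (fun p => (hf p.1).comp isClosed_frontier.isClosedEmbedding_subtypeVal)
      (fun p => by simpa only [mul_one] using (hlip p.1).comp (LipschitzWith.subtype_val _))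
      (fun p => hfrontier p.1 _ p.2.2)
    refine ⟨A, Fin.cons _ C,
      Fin.cases (indNonpos_iUnion_range_sdiff_frontier hf h𝒱 hcount) hC, fun z hz => ?_,
      fun hne => ?_⟩
    · by_cases hzF : z ∈ ⋃ j, ⋃ B ∈ 𝒱 j, f j '' frontier B
      · simp only [mem_iUnion] at hzF
        obtain ⟨j, B, hB, y, hy, rfl⟩ := hzF
        refine (hAC (mem_iUnion.2 ⟨⟨j, B, hB⟩, ⟨y, hy⟩, rfl⟩)).imp_right fun h => ?_
        obtain ⟨i, hi⟩ := mem_iUnion.1 h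
        exact mem_iUnion.2 ⟨i.succ, hi⟩
      · exact Or.inr (mem_iUnion.2 ⟨0, hz, hzF⟩)
    · rw [Nat.cast_succ, ← add_assoc]
      exact EReal.add_le_of_le_sub (hA hne)

theorem exists_separators_of_inductiveTopHausdorffDim_lt {Z : Type*} [MetricSpace Z]
    [SeparableSpace Z] {n : ℕ} {d : EReal} (hd : inductiveTopHausdorffDim n Z < d)
    {E H : Fin n → Set Z} (hE : ∀ i, IsClosed (E i)) (hH : ∀ i, IsClosed (H i))
    (hEH : ∀ i, Disjoint (E i) (H i)) :
    ∃ U V : Fin n → Set Z, (∀ i, IsOpen (U i)) ∧ (∀ i, IsOpen (V i)) ∧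
      (∀ i, Disjoint (U i) (V i)) ∧ (∀ i, E i ⊆ U i) ∧ (∀ i, H i ⊆ V i) ∧
      ((⋂ i, (U i ∪ V i)ᶜ).Nonempty →
        ((dimH (⋂ i, (U i ∪ V i)ᶜ) : ℝ≥0∞) : EReal) + n ≤ d) := by
  obtain ⟨A, C, hC, hAC, hA⟩ := exists_indNonpos_decomposition n
    (fun _ : PUnit => IsClosedEmbedding.id (X := Z)) (fun _ => LipschitzWith.id) fun _ => hd
  choose U V hU hV hUV hEU hHV hCUV using fun i =>
    exists_isOpen_separation_of_indNonpos (hC i) (hE i) (hH i) (hEH i)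
  have hsub : ⋂ i, (U i ∪ V i)ᶜ ⊆ A := fun z hz => by
    refine (hAC (mem_iUnion.2 ⟨⟨⟩, z, rfl⟩)).resolve_right fun h => ?_
    obtain ⟨i, hi⟩ := mem_iUnion.1 h
    exact mem_iInter.1 hz i (hCUV i hi)
  refine ⟨U, V, hU, hV, hUV, hEU, hHV, fun hne => le_trans ?_ (hA (hne.mono hsub))⟩
  gcongr
  exact EReal.coe_ennreal_le_coe_ennreal_iff.2 (dimH_mono hsub)

/-! ### A cubical lemma of Kuhn -/

section Cubical

variable {ι : Type*} [DecidableEq ι]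

/-- Coboundary of a cochain modulo 2 on the cubical lattice `ι → ℕ`; `F S p` is the value of the
cochain on the unit cube with lowest vertex `p` and set of directions `S`. -/
def cubicalCoboundary (F : Finset ι → (ι → ℕ) → ZMod 2) (S : Finset ι) (p : ι → ℕ) : ZMod 2 :=
  ∑ s ∈ S, (F (S.erase s) (p + Pi.single s 1) + F (S.erase s) p)

/-- The cup product of the coboundaries of the functions in a list, given recursively by
`dc ∪ η = d (c ∪ η)` for a cocycle `η`. -/
def coboundaryCupProduct : List ((ι → ℕ) → ZMod 2) → Finset ι → (ι → ℕ) → ZMod 2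
  | [] => fun _ _ => 1
  | c :: cs => cubicalCoboundary fun S p => c p * coboundaryCupProduct cs S p

theorem sum_erase_eq_zero_of_symm (S : Finset ι) (f : ι → ι → ZMod 2)
    (hf : ∀ s t, f s t = f t s) : ∑ s ∈ S, ∑ t ∈ S.erase s, f s t = 0 := by
  rw [Finset.sum_sigma']
  refine Finset.sum_involution (fun x _ => ⟨x.2, x.1⟩) ?_ ?_ ?_ ?_
  · intro x _
    rw [hf x.2 x.1]
    exact CharTwo.add_self_eq_zero _
  · rintro ⟨s, t⟩ hx _ h
    simp only [Finset.mem_sigma, Finset.mem_erase] at hx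
    exact hx.2.1 (congrArg Sigma.fst h)
  · rintro ⟨s, t⟩ hx
    simp only [Finset.mem_sigma, Finset.mem_erase] at hx ⊢
    exact ⟨hx.2.2, hx.2.1.symm, hx.1⟩
  · rintro ⟨s, t⟩ _
    rfl

theorem cubicalCoboundary_cubicalCoboundary (F : Finset ι → (ι → ℕ) → ZMod 2) (S : Finset ι)
    (p : ι → ℕ) : cubicalCoboundary (cubicalCoboundary F) S p = 0 := by
  simp only [cubicalCoboundary, ← Finset.sum_add_distrib]
  refine sum_erase_eq_zero_of_symm S _ fun s t => ?_
  rw [Finset.erase_right_comm, add_right_comm p]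
  ring

theorem cubicalCoboundary_coboundaryCupProduct (cs : List ((ι → ℕ) → ZMod 2)) (S : Finset ι)
    (p : ι → ℕ) : cubicalCoboundary (coboundaryCupProduct cs) S p = 0 := by
  cases cs with
  | nil => exact Finset.sum_eq_zero fun _ _ => CharTwo.add_self_eq_zero 1
  | cons c cs => exact cubicalCoboundary_cubicalCoboundary _ S p

/-- The vertices of the unit cube with lowest vertex `p` and set of directions `S`. -/
def cubeVertices (S : Finset ι) (p : ι → ℕ) : Set (ι → ℕ) :=
  {u | ∀ j, p j ≤ u j ∧ u j ≤ p j + if j ∈ S then 1 else 0}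

theorem cubeVertices_erase_subset (S : Finset ι) (s : ι) (p : ι → ℕ) :
    cubeVertices (S.erase s) p ⊆ cubeVertices S p := by
  intro u hu j
  have := hu j
  grind

theorem cubeVertices_erase_add_single_subset {S : Finset ι} {s : ι} (hs : s ∈ S) (p : ι → ℕ) :
    cubeVertices (S.erase s) (p + Pi.single s 1) ⊆ cubeVertices S p := by
  intro u hu j
  have := hu j
  simp only [Pi.add_apply, Pi.single_apply] at this
  grind

theorem self_mem_cubeVertices (S : Finset ι) (p : ι → ℕ) : p ∈ cubeVertices S p := fun _ =>
  ⟨le_rfl, Nat.le_add_right _ _⟩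

theorem coboundaryCupProduct_eq_zero_of_eqOn {cs : List ((ι → ℕ) → ZMod 2)}
    {c : (ι → ℕ) → ZMod 2} (hc : c ∈ cs) {S : Finset ι} {p : ι → ℕ} {x : ZMod 2}
    (hx : ∀ u ∈ cubeVertices S p, c u = x) : coboundaryCupProduct cs S p = 0 := by
  induction cs generalizing S p with
  | nil => exact absurd hc List.not_mem_nil
  | cons a cs ih =>
    rcases List.mem_cons.1 hc with rfl | hc
    · calc coboundaryCupProduct (c :: cs) S p
          = x * cubicalCoboundary (coboundaryCupProduct cs) S p := by
            rw [cubicalCoboundary, Finset.mul_sum]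
            refine Finset.sum_congr rfl fun s hs => ?_
            beta_reduce
            rw [hx _ (cubeVertices_erase_add_single_subset hs p (self_mem_cubeVertices _ _)),
              hx p (self_mem_cubeVertices S p), mul_add]
        _ = 0 := by rw [cubicalCoboundary_coboundaryCupProduct, mul_zero]
    · refine Finset.sum_eq_zero fun s hs => ?_
      beta_reduce
      rw [ih hc fun u hu => hx u (cubeVertices_erase_add_single_subset hs p hu),
        ih hc fun u hu => hx u (cubeVertices_erase_subset S s p hu), mul_zero, mul_zero, add_zero]

variable [Fintype ι]

/-- The lowest vertices of the unit cubes that tile the face of `[0, N]^ι` with directions `L`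
through `q`. -/
def gridBox (N : ℕ) (L : Finset ι) (q : ι → ℕ) : Finset (ι → ℕ) :=
  Fintype.piFinset fun j => if j ∈ L then Finset.range N else {q j}

theorem mem_gridBox {N : ℕ} {L : Finset ι} {q p : ι → ℕ} :
    p ∈ gridBox N L q ↔ ∀ j, if j ∈ L then p j < N else p j = q j := by
  rw [gridBox, Fintype.mem_piFinset]
  refine forall_congr' fun j => ?_
  split_ifs <;> simp only [Finset.mem_range, Finset.mem_singleton]

theorem apply_eq_of_mem_gridBox_update {N a : ℕ} {L : Finset ι} {q p : ι → ℕ} {s : ι} (hs : s ∉ L)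
    (hp : p ∈ gridBox N L (Function.update q s a)) : p s = a := by
  simpa only [if_neg hs, Function.update_self] using mem_gridBox.1 hp s

theorem sum_gridBox_insert {N : ℕ} {L : Finset ι} {s : ι} (hs : s ∉ L) (q : ι → ℕ)
    (G : (ι → ℕ) → ZMod 2) : ∑ p ∈ gridBox N (insert s L) q, G p =
      ∑ a ∈ Finset.range N, ∑ p ∈ gridBox N L (Function.update q s a), G p := by
  have hmaps : ∀ p ∈ gridBox N (insert s L) q, p s ∈ Finset.range N := fun p hp => by
    simpa only [Finset.mem_insert_self, if_true, Finset.mem_range] using mem_gridBox.1 hp s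
  rw [← Finset.sum_fiberwise_of_maps_to hmaps]
  refine Finset.sum_congr rfl fun a ha => Finset.sum_congr ?_ fun _ _ => rfl
  ext p
  simp only [Finset.mem_filter, mem_gridBox, Finset.mem_insert, Function.update_apply,
    Finset.mem_range] at ha ⊢
  grind

theorem sum_gridBox_add_single {N : ℕ} {L : Finset ι} {s : ι} (hs : s ∉ L) (q : ι → ℕ) (a : ℕ)
    (G : (ι → ℕ) → ZMod 2) : ∑ p ∈ gridBox N L (Function.update q s a), G (p + Pi.single s 1) =
      ∑ p ∈ gridBox N L (Function.update q s (a + 1)), G p := by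
  refine Finset.sum_nbij' (· + Pi.single s 1) (· - Pi.single s 1) (fun p hp => ?_) (fun p hp => ?_)
    (fun p _ => add_tsub_cancel_right _ _) (fun p hp => ?_) fun _ _ => rfl
  · rw [mem_gridBox] at hp ⊢
    intro j
    have := hp j
    simp only [Pi.add_apply, Pi.single_apply, Function.update_apply] at this ⊢
    grind
  · rw [mem_gridBox] at hp ⊢
    intro j
    have := hp j
    simp only [Pi.sub_apply, Pi.single_apply, Function.update_apply] at this ⊢
    grind
  · refine tsub_add_cancel_of_le fun j => ?_
    have := apply_eq_of_mem_gridBox_update hs hp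
    rw [Pi.single_apply]
    grind

theorem sum_gridBox_telescope {N : ℕ} {L : Finset ι} {s : ι} (hs : s ∉ L) (q : ι → ℕ)
    (G : (ι → ℕ) → ZMod 2) :
    ∑ p ∈ gridBox N (insert s L) q, (G (p + Pi.single s 1) + G p) =
      ∑ p ∈ gridBox N L (Function.update q s N), G p +
        ∑ p ∈ gridBox N L (Function.update q s 0), G p := by
  simp only [sum_gridBox_insert hs, Finset.sum_add_distrib, sum_gridBox_add_single hs]
  rw [← Finset.sum_add_distrib]
  simpa only [CharTwo.sub_eq_add] using
    Finset.sum_range_sub (fun a => ∑ p ∈ gridBox N L (Function.update q s a), G p) N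

theorem sum_gridBox_cubicalCoboundary (N : ℕ) (S : Finset ι) (q : ι → ℕ)
    (F : Finset ι → (ι → ℕ) → ZMod 2) : ∑ p ∈ gridBox N S q, cubicalCoboundary F S p =
      ∑ s ∈ S, (∑ p ∈ gridBox N (S.erase s) (Function.update q s N), F (S.erase s) p +
        ∑ p ∈ gridBox N (S.erase s) (Function.update q s 0), F (S.erase s) p) := by
  simp only [cubicalCoboundary]
  rw [Finset.sum_comm]
  refine Finset.sum_congr rfl fun s hs => ?_
  rw [← sum_gridBox_telescope (Finset.notMem_erase s S), Finset.insert_erase hs]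

theorem sum_gridBox_mul_coboundaryCupProduct_eq_zero {cs : List ((ι → ℕ) → ZMod 2)}
    {c : (ι → ℕ) → ZMod 2} (hc : c ∈ cs) {s : ι} {a : ℕ} {x : ZMod 2}
    (hx : ∀ p : ι → ℕ, p s = a → c p = x) {L : Finset ι} (hs : s ∉ L) (N : ℕ) (q : ι → ℕ)
    (f : (ι → ℕ) → ZMod 2) :
    ∑ p ∈ gridBox N L (Function.update q s a), f p * coboundaryCupProduct cs L p = 0 := by
  refine Finset.sum_eq_zero fun p hp => ?_
  have hps : p s = a := apply_eq_of_mem_gridBox_update hs hp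
  have hconst : ∀ u ∈ cubeVertices L p, c u = x := fun u hu => hx u <| by
    have := hu s
    rw [if_neg hs] at this
    lia
  rw [coboundaryCupProduct_eq_zero_of_eqOn hc hconst, mul_zero]

theorem sum_gridBox_coboundaryCupProduct {N : ℕ} {b : ι → (ι → ℕ) → ZMod 2}
    (hb0 : ∀ i (p : ι → ℕ), p i = 0 → b i p = 0) (hb1 : ∀ i (p : ι → ℕ), p i = N → b i p = 1)
    {l : List ι} (hl : l.Nodup) (q : ι → ℕ) :
    ∑ p ∈ gridBox N l.toFinset q, coboundaryCupProduct (l.map b) l.toFinset p = 1 := by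
  induction l generalizing q with
  | nil =>
    have : gridBox N ∅ q = {q} := by
      ext p
      simp only [mem_gridBox, Finset.notMem_empty, if_false, Finset.mem_singleton, funext_iff]
    rw [List.toFinset_nil, this, Finset.sum_singleton]
    rfl
  | cons i l ih =>
    obtain ⟨hil, hl'⟩ := List.nodup_cons.1 hl
    rw [← List.mem_toFinset] at hil
    simp only [List.toFinset_cons, List.map_cons, coboundaryCupProduct]
    rw [sum_gridBox_cubicalCoboundary, Finset.sum_insert hil, Finset.erase_insert hil]
    have hface1 : ∑ p ∈ gridBox N l.toFinset (Function.update q i N),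
        b i p * coboundaryCupProduct (l.map b) l.toFinset p = 1 := by
      rw [← ih hl' (Function.update q i N)]
      refine Finset.sum_congr rfl fun p hp => ?_
      rw [hb1 i p (apply_eq_of_mem_gridBox_update hil hp), one_mul]
    have hface0 : ∑ p ∈ gridBox N l.toFinset (Function.update q i 0),
        b i p * coboundaryCupProduct (l.map b) l.toFinset p = 0 := by
      refine Finset.sum_eq_zero fun p hp => ?_
      rw [hb0 i p (apply_eq_of_mem_gridBox_update hil hp), zero_mul]
    rw [hface1, hface0, add_zero, add_eq_left]
    refine Finset.sum_eq_zero fun s hs => ?_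
    have hsl := List.mem_map_of_mem (f := b) (List.mem_toFinset.1 hs)
    rw [sum_gridBox_mul_coboundaryCupProduct_eq_zero hsl (hb1 s) (Finset.notMem_erase s _),
      sum_gridBox_mul_coboundaryCupProduct_eq_zero hsl (hb0 s) (Finset.notMem_erase s _), add_zero]

end Cubical

/-- Otherwise some label is constant on each unit cube, so the cup product of the coboundaries of
all labels vanishes on all top-dimensional unit cubes; but its sum over them is `1`. -/
theorem exists_cube_forall_not_constant {ι : Type*} [Finite ι] {N : ℕ}
    {b : ι → (ι → ℕ) → ZMod 2}
    (hb0 : ∀ i (p : ι → ℕ), p i = 0 → b i p = 0) (hb1 : ∀ i (p : ι → ℕ), p i = N → b i p = 1) :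
    ∃ p : ι → ℕ, ∀ i x, ∃ u ∈ Icc p (p + 1), b i u ≠ x := by
  classical
  have := Fintype.ofFinite ι
  have hsum := sum_gridBox_coboundaryCupProduct hb0 hb1 (Finset.univ : Finset ι).nodup_toList 0
  obtain ⟨p, -, hp⟩ := Finset.exists_ne_zero_of_sum_ne_zero (hsum.trans_ne one_ne_zero)
  refine ⟨p, fun i x => ?_⟩
  by_contra! hx
  refine hp (coboundaryCupProduct_eq_zero_of_eqOn (x := x)
    (List.mem_map_of_mem (Finset.mem_toList.2 (Finset.mem_univ i))) fun u hu => hx u ?_)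
  simpa [cubeVertices, Pi.le_def, forall_and] using hu

theorem dist_projIcc_div_lt {u p n : ℕ} (h : p ≤ u) (h' : u ≤ p + 1) {δ : ℝ}
    (hn : 1 / ((n : ℝ) + 1) < δ) :
    dist (projIcc (0 : ℝ) 1 zero_le_one (u / (n + 1))) (projIcc 0 1 zero_le_one (p / (n + 1))) <
      δ := by
  calc _ ≤ dist ((u : ℝ) / (n + 1)) (p / (n + 1)) := by
        simpa using (LipschitzWith.projIcc (a := (0 : ℝ)) (b := 1) zero_le_one).dist_le_mul _ _
    _ = (u - p) / (n + 1) := by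
        rw [Real.dist_eq, ← sub_div, abs_of_nonneg]
        have : (p : ℝ) ≤ u := by exact_mod_cast h
        exact div_nonneg (sub_nonneg.2 this) (by positivity)
    _ ≤ 1 / (n + 1) := by
        gcongr
        rw [sub_le_iff_le_add']
        exact_mod_cast h'
    _ < δ := hn

/-- Label a fine grid in the cube by `b i = 0` on `U i` and `b i = 1` elsewhere. If the separators
covered the cube, a ball containing a unit cube of the grid would lie in some `U i` or `V i`, and
`b i` would be constant on that unit cube. -/
theorem exists_forall_notMem_of_separate_faces {ι : Type*} [Finite ι]
    {U V : ι → Set (ι → Icc (0 : ℝ) 1)} (hU : ∀ i, IsOpen (U i)) (hV : ∀ i, IsOpen (V i))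
    (hUV : ∀ i, Disjoint (U i) (V i)) (h0 : ∀ i x, x i = 0 → x ∈ U i)
    (h1 : ∀ i x, x i = 1 → x ∈ V i) : ∃ x, ∀ i, x ∉ U i ∪ V i := by
  classical
  have := Fintype.ofFinite ι
  by_contra! hcov
  obtain ⟨δ, hδ, hleb⟩ := lebesgue_number_lemma_of_metric
    (isCompact_univ (X := ι → Icc (0 : ℝ) 1)) (c := Sum.elim U V) (Sum.forall.2 ⟨hU, hV⟩)
    fun x _ => mem_iUnion.2 <| Sum.exists.2 <| exists_or.1 (hcov x)
  obtain ⟨n, hn⟩ := exists_nat_one_div_lt hδ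
  let g (p : ι → ℕ) (i : ι) : Icc (0 : ℝ) 1 := projIcc 0 1 zero_le_one (p i / (n + 1))
  have hg0 (i) (p : ι → ℕ) (hp : p i = 0) : g p ∈ U i := h0 i _ (by
    simp only [g, hp, Nat.cast_zero, zero_div]
    exact projIcc_left (zero_le_one (α := ℝ)))
  have hg1 (i) (p : ι → ℕ) (hp : p i = n + 1) : g p ∈ V i := h1 i _ (by
    simp only [g, hp, Nat.cast_succ, div_self (n.cast_add_one_ne_zero (R := ℝ))]
    exact projIcc_right (zero_le_one (α := ℝ)))
  obtain ⟨p, hp⟩ := exists_cube_forall_not_constant (N := n + 1)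
    (b := fun i p => if g p ∈ U i then 0 else 1) (fun i p h => if_pos (hg0 i p h))
    fun i p h => if_neg ((hUV i).notMem_of_mem_right (hg1 i p h))
  have hball : ∀ u ∈ Icc p (p + 1), g u ∈ Metric.ball (g p) δ := fun u hu =>
    (dist_pi_lt_iff hδ).2 fun i => dist_projIcc_div_lt (hu.1 i) (hu.2 i) hn
  obtain ⟨i | i, hi⟩ := hleb (g p) (mem_univ _)
  · obtain ⟨u, hu, hne⟩ := hp i 0
    exact hne (if_pos (hi (hball u hu)))
  · obtain ⟨u, hu, hne⟩ := hp i 1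
    exact hne (if_neg ((hUV i).notMem_of_mem_right (hi (hball u hu))))

/-! ### Fibres of Lipschitz functions -/

section HausdorffMeasure

variable {Z : Type*} [EMetricSpace Z] [MeasurableSpace Z] [BorelSpace Z] {s : ℝ} {A : Set Z}

/-- The diameters are replaced by positive numbers `δ i`, which can serve as scales of box
covers. -/
theorem exists_cover_of_hausdorffMeasure_eq_zero (hs : 0 < s) (h : μH[s] A = 0) {ε : ℝ≥0∞}
    (hε : 0 < ε) : ∃ (E : ℕ → Set Z) (δ : ℕ → ℝ≥0∞), A ⊆ ⋃ i, E i ∧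
      (∀ i, Metric.ediam (E i) ≤ δ i) ∧ (∀ i, 0 < δ i) ∧ (∀ i, δ i ≤ ε) ∧
      ∑' i, δ i ^ s ≤ ε := by
  have hε2 : 0 < ε / 2 := ENNReal.half_pos hε.ne'
  obtain ⟨E, hE, hEε, hEs⟩ : ∃ E : ℕ → Set Z, A ⊆ ⋃ i, E i ∧ (∀ i, Metric.ediam (E i) ≤ ε) ∧
      ∑' i, ⨆ _ : (E i).Nonempty, Metric.ediam (E i) ^ s < ε / 2 := by
    simpa only [iInf_lt_iff, exists_prop] using (le_iSup₂_of_le ε hε le_rfl).trans_lt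
      ((hausdorffMeasure_apply s A).symm.trans_lt (h.trans_lt hε2))
  obtain ⟨η, hη, hηε⟩ := ENNReal.exists_pos_sum_of_countable' hε2.ne' ℕ
  refine ⟨E, fun i => max (Metric.ediam (E i)) (min (η i ^ s⁻¹) ε), hE, fun i => le_max_left _ _,
    fun i => lt_max_of_lt_right
      (lt_min (ENNReal.rpow_pos_of_nonneg (hη i) (inv_nonneg.2 hs.le)) hε),
    fun i => max_le (hEε i) (min_le_right _ _), ?_⟩
  have hterm : ∀ i, max (Metric.ediam (E i)) (min (η i ^ s⁻¹) ε) ^ s ≤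
      (⨆ _ : (E i).Nonempty, Metric.ediam (E i) ^ s) + η i := by
    intro i
    rw [(ENNReal.monotone_rpow_of_nonneg hs.le).map_max]
    refine max_le (le_add_right ?_) (le_add_left ?_)
    · rcases (E i).eq_empty_or_nonempty with he | hne
      · simp only [he, Metric.ediam_empty, ENNReal.zero_rpow_of_pos hs, zero_le]
      · rw [ciSup_pos hne]
    · calc min (η i ^ s⁻¹) ε ^ s ≤ (η i ^ s⁻¹) ^ s :=
            ENNReal.rpow_le_rpow (min_le_left _ _) hs.le
        _ = η i := ENNReal.rpow_inv_rpow hs.ne' _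
  calc ∑' i, max (Metric.ediam (E i)) (min (η i ^ s⁻¹) ε) ^ s
      ≤ (∑' i, ⨆ _ : (E i).Nonempty, Metric.ediam (E i) ^ s) + ∑' i, η i :=
        (ENNReal.tsum_le_tsum hterm).trans_eq ENNReal.tsum_add
    _ ≤ ε / 2 + ε / 2 := add_le_add hEs.le hηε.le
    _ = ε := ENNReal.add_halves ε

theorem hausdorffMeasure_eq_zero_of_forall_exists_cover
    (h : ∀ ε : ℝ≥0∞, 0 < ε → ∃ (κ : Type u) (_ : Countable κ) (E : κ → Set Z), A ⊆ ⋃ i, E i ∧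
      (∀ i, Metric.ediam (E i) ≤ ε) ∧ ∑' i, Metric.ediam (E i) ^ s ≤ ε) : μH[s] A = 0 := by
  choose κ hκ E hA hE hs using fun n : ℕ => h ((n : ℝ≥0∞)⁻¹) (by simp)
  have hlim := ENNReal.tendsto_inv_nat_nhds_zero
  have hle := hausdorffMeasure_le_liminf_tsum s A _ hlim E (.of_forall hE) (.of_forall hA)
  exact le_zero_iff.1 <| (hle.trans (liminf_le_liminf (.of_forall hs))).trans_eq hlim.liminf_eq

end HausdorffMeasure

section Fibres

variable {Z : Type*}

section EMetric

variable [EMetricSpace Z] {f : Z → ℝ} {K : ℝ≥0}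

theorem lintegral_tsum_indicator_image_le (hf : LipschitzWith K f) {s : ℝ} (hs : 0 ≤ s)
    {E : ℕ → Set Z} {δ : ℕ → ℝ≥0∞} (hE : ∀ i, Metric.ediam (E i) ≤ δ i) :
    ∫⁻ t, ∑' i, (closure (f '' E i)).indicator (fun _ => δ i ^ s) t ≤
      K * ∑' i, δ i ^ (s + 1) := by
  have hm (i) : MeasurableSet (closure (f '' E i)) := isClosed_closure.measurableSet
  rw [lintegral_tsum fun i => (measurable_const.indicator (hm i)).aemeasurable,
    ← ENNReal.tsum_mul_left]
  refine ENNReal.tsum_le_tsum fun i => ?_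
  have hvol : volume (closure (f '' E i)) ≤ K * δ i :=
    calc volume (closure (f '' E i)) ≤ Metric.ediam (f '' E i) :=
          (Real.volume_le_diam _).trans_eq (Metric.ediam_closure _)
      _ ≤ K * Metric.ediam (E i) := hf.ediam_image_le _
      _ ≤ K * δ i := by gcongr; exact hE i
  rw [lintegral_indicator_const (hm i), ENNReal.rpow_add_of_nonneg _ _ hs zero_le_one,
    ENNReal.rpow_one, mul_left_comm]
  gcongr

variable [MeasurableSpace Z] [BorelSpace Z]

theorem ae_hausdorffMeasure_fiber_eq_zero (hf : LipschitzWith K f) {s : ℝ} (hs : 0 ≤ s)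
    (h : μH[s + 1] (univ : Set Z) = 0) : ∀ᵐ t : ℝ, μH[s] (f ⁻¹' {t}) = 0 := by
  choose E δ hEuniv hE _ hδ hδs using fun n : ℕ =>
    exists_cover_of_hausdorffMeasure_eq_zero (by positivity) h (ENNReal.pow_pos (by simp) n :
      (0 : ℝ≥0∞) < 2⁻¹ ^ n)
  let g (n : ℕ) (t : ℝ) : ℝ≥0∞ :=
    ∑' i, (closure (f '' E n i)).indicator (fun _ => δ n i ^ s) t
  have hg (n) : Measurable (g n) := Measurable.tsum fun i =>
    measurable_const.indicator isClosed_closure.measurableSet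
  have hint : ∫⁻ t, ∑' n, g n t ≠ ∞ := by
    rw [lintegral_tsum fun n => (hg n).aemeasurable]
    have hgn (n) : ∫⁻ t, g n t ≤ K * 2⁻¹ ^ n :=
      (lintegral_tsum_indicator_image_le hf hs (hE n)).trans (mul_le_mul_right (hδs n) _)
    refine ne_top_of_le_ne_top ?_ (ENNReal.tsum_le_tsum hgn)
    rw [ENNReal.tsum_mul_left, ENNReal.tsum_geometric, ENNReal.one_sub_inv_two, inv_inv]
    exact ENNReal.mul_ne_top ENNReal.coe_ne_top ENNReal.ofNat_ne_top
  filter_upwards [ae_lt_top (Measurable.tsum hg) hint] with t ht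
  refine hausdorffMeasure_eq_zero_of_forall_exists_cover fun ε hε => ?_
  obtain ⟨n, hgn, hn⟩ : ∃ n, g n t ≤ ε ∧ 2⁻¹ ^ n ≤ ε :=
    ((ENNReal.tendsto_atTop_zero_of_tsum_ne_top ht.ne).eventually_le_const hε |>.and <|
      (ENNReal.tendsto_pow_atTop_nhds_zero_of_lt_one
        ENNReal.one_half_lt_one).eventually_le_const hε).exists
  refine ⟨{i // t ∈ closure (f '' E n i)}, inferInstance, fun i => E n i, ?_,
    fun i => (hE n i).trans ((hδ n i).trans hn), ?_⟩
  · intro z hz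
    obtain ⟨i, hi⟩ := mem_iUnion.1 (hEuniv n (mem_univ z))
    exact mem_iUnion.2 ⟨⟨i, subset_closure ⟨z, hi, hz⟩⟩, hi⟩
  · calc ∑' i : {i // t ∈ closure (f '' E n i)}, Metric.ediam (E n i) ^ s
        ≤ ∑' i : {i | t ∈ closure (f '' E n i)}, δ n i ^ s :=
          ENNReal.tsum_le_tsum fun i => ENNReal.rpow_le_rpow (hE n i) hs
      _ = g n t := tsum_subtype {i | t ∈ closure (f '' E n i)} fun i => δ n i ^ s
      _ ≤ ε := hgn

end EMetric

theorem ae_dimH_fiber_add_one_le [EMetricSpace Z] {f : Z → ℝ} {K : ℝ≥0} (hf : LipschitzWith K f) :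
    ∀ᵐ t : ℝ, (f ⁻¹' {t}).Nonempty → dimH (f ⁻¹' {t}) + 1 ≤ dimH (univ : Set Z) := by
  borelize Z
  have hzero (q : ℝ≥0) (hq : dimH (univ : Set Z) < q + 1) : ∀ᵐ t : ℝ, μH[q] (f ⁻¹' {t}) = 0 := by
    refine ae_hausdorffMeasure_fiber_eq_zero hf q.2 ?_
    exact_mod_cast hausdorffMeasure_of_dimH_lt (d := q + 1) (by exact_mod_cast hq)
  have hall : ∀ᵐ t : ℝ, ∀ q : ℚ, dimH (univ : Set Z) < ((q : ℝ).toNNReal : ℝ≥0∞) + 1 →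
      μH[(q : ℝ).toNNReal] (f ⁻¹' {t}) = 0 :=
    ae_all_iff.2 fun q => eventually_imp_distrib_left.2 (hzero _)
  filter_upwards [hall] with t ht hne
  have hone : 1 ≤ dimH (univ : Set Z) := by
    by_contra! hlt
    have h0 : μH[0] (f ⁻¹' {t}) = 0 := by simpa using ht 0 (by simpa using hlt)
    exact (one_le_hausdorffMeasure_zero_of_nonempty hne).not_gt (h0.trans_lt one_pos)
  rw [← tsub_add_cancel_of_le hone]
  gcongr
  refine le_of_forall_gt_imp_ge_of_dense fun a ha => ?_
  obtain ⟨q, -, hq, hqa⟩ := ENNReal.lt_iff_exists_rat_btwn.1 ha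
  have := ht q ((ENNReal.sub_lt_iff_lt_right ENNReal.one_ne_top hone).1 hq)
  exact (dimH_le_of_hausdorffMeasure_ne_top (this.trans_ne ENNReal.zero_ne_top)).trans hqa.le

end Fibres

/-! ### Dimensions decrease in `n` -/

theorem hausdorffDim_coe_set {Z : Type*} [MetricSpace Z] {F : Set Z} (hF : F.Nonempty) :
    hausdorffDim F = ((dimH F : ℝ≥0∞) : EReal) := by
  have := hF.to_subtype
  rw [hausdorffDim_of_nonempty, ← (isometry_subtype_coe (s := F)).dimH_image, image_univ,
    Subtype.range_coe]

theorem neg_one_le_hausdorffDim_sub_one (Z : Type*) [MetricSpace Z] [Nonempty Z] :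
    -1 ≤ hausdorffDim Z - 1 := by
  rw [hausdorffDim_of_nonempty, ← zero_sub]
  exact EReal.sub_le_sub (EReal.coe_ennreal_nonneg _) le_rfl

theorem exists_ball_hausdorffDim_frontier_le {Z : Type*} [MetricSpace Z] (x : Z) {ε : ℝ}
    (hε : 0 < ε) :
    ∃ r, 0 < r ∧ r < ε ∧ hausdorffDim (frontier (Metric.ball x r)) ≤ hausdorffDim Z - 1 := by
  have : Nonempty Z := ⟨x⟩
  obtain ⟨r, hr, hr0, hrε⟩ :=
    (dense_of_ae (ae_dimH_fiber_add_one_le (LipschitzWith.dist_left x))).exists_between hε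
  refine ⟨r, hr0, hrε, ?_⟩
  rcases (frontier (Metric.ball x r)).eq_empty_or_nonempty with he | hne
  · rw [hausdorffDim, if_pos (isEmpty_coe_sort.2 he)]
    exact neg_one_le_hausdorffDim_sub_one Z
  · have hsphere : frontier (Metric.ball x r) ⊆ (dist · x) ⁻¹' {r} :=
      Metric.frontier_ball_subset_sphere
    rw [hausdorffDim_coe_set hne, hausdorffDim_of_nonempty,
      EReal.le_sub_iff_add_le (.inl (by decide)) (.inl (by decide))]
    exact_mod_cast (add_le_add_left (dimH_mono hsphere) 1).trans (hr (hne.mono hsphere))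

theorem inductiveTopHausdorffDim_one_le (Z : Type*) [MetricSpace Z] :
    inductiveTopHausdorffDim 1 Z ≤ hausdorffDim Z := by
  rw [inductiveTopHausdorffDim]
  split_ifs with hZ
  · rw [hausdorffDim, if_pos hZ]
  refine sInf_le ⟨{U | IsOpen U ∧ hausdorffDim (frontier U) ≤ hausdorffDim Z - 1}, ?_,
    fun U hU => hU.2⟩
  refine isTopologicalBasis_of_isOpen_of_nhds (fun U hU => hU.1) fun x O hx hO => ?_
  obtain ⟨ε, hε, hball⟩ := Metric.isOpen_iff.1 hO x hx
  obtain ⟨r, hr0, hrε, hr⟩ := exists_ball_hausdorffDim_frontier_le x hε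
  exact ⟨Metric.ball x r, ⟨Metric.isOpen_ball, hr⟩, Metric.mem_ball_self hr0,
    (Metric.ball_subset_ball hrε.le).trans hball⟩

theorem inductiveTopHausdorffDim_succ_le (n : ℕ) (Z : Type*) [MetricSpace Z] :
    inductiveTopHausdorffDim (n + 1) Z ≤ inductiveTopHausdorffDim n Z := by
  induction n generalizing Z with
  | zero => exact inductiveTopHausdorffDim_one_le Z
  | succ n ih =>
    rw [inductiveTopHausdorffDim, inductiveTopHausdorffDim]
    split_ifs with hZ
    · exact le_rfl
    · refine sInf_le_sInf ?_
      rintro d ⟨𝒰, h𝒰, hd⟩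
      exact ⟨𝒰, h𝒰, fun U hU => (ih _).trans (hd U hU)⟩

theorem inductiveTopHausdorffDim_antitone (Z : Type*) [MetricSpace Z] :
    Antitone fun n => inductiveTopHausdorffDim n Z :=
  antitone_nat_of_succ_le fun n => inductiveTopHausdorffDim_succ_le n Z

/-! ### Products with cubes -/

/-- `Y` has upper box dimension at most `t` with finite upper Minkowski content: it has covers by
`O(r ^ (-t))` sets of diameter at most `r`. -/
def HasBoxCovers (Y : Type*) [PseudoEMetricSpace Y] (t : ℝ≥0) : Prop :=
  ∃ C : ℝ≥0∞, C ≠ ∞ ∧ ∀ r : ℝ≥0∞, 0 < r → r ≤ 1 → ∃ 𝒞 : Finset (Set Y), ⋃₀ ↑𝒞 = (univ : Set Y) ∧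
    (∀ c ∈ 𝒞, Metric.ediam c ≤ r) ∧ 𝒞.card * r ^ (t : ℝ) ≤ C

theorem hasBoxCovers_unitInterval : HasBoxCovers (Icc (0 : ℝ) 1) 1 := by
  refine ⟨2, ENNReal.ofNat_ne_top, fun r hr0 hr1 => ?_⟩
  lift r to ℝ≥0 using ne_top_of_le_ne_top ENNReal.one_ne_top hr1
  have hr : (0 : ℝ) < r := by exact_mod_cast hr0
  classical
  let piece (j : ℕ) : Set (Icc (0 : ℝ) 1) := {y | ⌊(y : ℝ) / r⌋₊ = j}
  refine ⟨(Finset.range (⌊1 / (r : ℝ)⌋₊ + 1)).image piece, ?_, ?_, ?_⟩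
  · refine eq_univ_of_forall fun y => mem_sUnion.2 ⟨piece ⌊(y : ℝ) / r⌋₊, ?_, rfl⟩
    refine Finset.mem_coe.2 (Finset.mem_image_of_mem _ (Finset.mem_range_succ_iff.2 ?_))
    exact Nat.floor_mono (by gcongr; exact y.2.2)
  · refine Finset.forall_mem_image.2 fun j _ => Metric.ediam_le fun y hy z hz => ?_
    have hmem (w : Icc (0 : ℝ) 1) (hw : w ∈ piece j) :
        (j * r : ℝ) ≤ w ∧ (w : ℝ) < (j + 1) * r := by
      rw [← le_div_iff₀ hr, ← div_lt_iff₀ hr, ← show _ = j from hw]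
      exact ⟨Nat.floor_le (div_nonneg w.2.1 hr.le), Nat.lt_floor_add_one _⟩
    rw [Subtype.edist_eq, edist_le_coe, ← NNReal.coe_le_coe, coe_nndist, Real.dist_eq, abs_le]
    constructor <;> linarith [hmem y hy, hmem z hz]
  · have hcard : ((Finset.range (⌊1 / (r : ℝ)⌋₊ + 1)).image piece).card ≤ ⌊1 / (r : ℝ)⌋₊ + 1 :=
      Finset.card_image_le.trans_eq (Finset.card_range _)
    have hbound : ((⌊1 / (r : ℝ)⌋₊ + 1 : ℕ) : ℝ) * r ≤ 2 := by
      have hfloor : (⌊1 / (r : ℝ)⌋₊ : ℝ) * r ≤ 1 :=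
        (le_div_iff₀ hr).1 (Nat.floor_le (by positivity))
      have : (r : ℝ) ≤ 1 := by exact_mod_cast hr1
      push_cast
      linarith
    rw [NNReal.coe_one, ENNReal.rpow_one]
    calc _ ≤ ((⌊1 / (r : ℝ)⌋₊ + 1 : ℕ) : ℝ≥0∞) * r := by gcongr
      _ ≤ 2 := by exact_mod_cast hbound

theorem HasBoxCovers.pi {ι Y : Type*} [Fintype ι] [PseudoEMetricSpace Y] {t : ℝ≥0}
    (hY : HasBoxCovers Y t) : HasBoxCovers (ι → Y) (t * Fintype.card ι) := by
  classical
  obtain ⟨C, hC, h⟩ := hY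
  refine ⟨C ^ Fintype.card ι, ENNReal.pow_ne_top hC, fun r hr0 hr1 => ?_⟩
  obtain ⟨𝒞, hcov, hdiam, hcard⟩ := h r hr0 hr1
  refine ⟨(Fintype.piFinset fun _ : ι => 𝒞).image (univ.pi), ?_, ?_, ?_⟩
  · refine eq_univ_of_forall fun y => ?_
    choose c hc hyc using fun i => mem_sUnion.1 (hcov ▸ mem_univ (y i) : y i ∈ ⋃₀ (𝒞 : Set (Set Y)))
    exact mem_sUnion.2 ⟨univ.pi c, Finset.mem_coe.2 (Finset.mem_image_of_mem _
      (Fintype.mem_piFinset.2 hc)), fun i _ => hyc i⟩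
  · refine Finset.forall_mem_image.2 fun c hc => Metric.ediam_le fun y hy z hz => ?_
    exact edist_pi_le_iff.2 fun i => (Metric.edist_le_ediam_of_mem (hy i trivial)
      (hz i trivial)).trans (hdiam _ (Fintype.mem_piFinset.1 hc i))
  · have hcard' : ((Fintype.piFinset fun _ : ι => 𝒞).image (univ.pi)).card ≤
        𝒞.card ^ Fintype.card ι :=
      Finset.card_image_le.trans_eq (by rw [Fintype.card_piFinset, Finset.prod_const]; rfl)
    calc _ ≤ (𝒞.card : ℝ≥0∞) ^ Fintype.card ι * r ^ (t * Fintype.card ι : ℝ) := by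
          push_cast
          gcongr
          exact_mod_cast hcard'
      _ = (𝒞.card * r ^ (t : ℝ)) ^ Fintype.card ι := by
          rw [ENNReal.rpow_mul_natCast, mul_pow]
      _ ≤ C ^ Fintype.card ι := by gcongr

section Prod

variable {X Y : Type*} [EMetricSpace X] [EMetricSpace Y] {t : ℝ≥0}

theorem HasBoxCovers.hausdorffMeasure_prod_eq_zero [MeasurableSpace X] [BorelSpace X]
    [MeasurableSpace (X × Y)] [BorelSpace (X × Y)] (hY : HasBoxCovers Y t) {s : ℝ}
    (hs : 0 < s) (hX : μH[s] (univ : Set X) = 0) : μH[s + t] (univ : Set (X × Y)) = 0 := by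
  obtain ⟨C, hC, hbox⟩ := hY
  refine hausdorffMeasure_eq_zero_of_forall_exists_cover fun ε hε => ?_
  obtain ⟨η, hη0, hη1, hηε, hηC⟩ : ∃ η > 0, η ≤ 1 ∧ η ≤ ε ∧ C * η ≤ ε :=
    ⟨min 1 (min ε (ε / C)), lt_min one_pos (lt_min hε (ENNReal.div_pos hε.ne' hC)),
      min_le_left _ _, (min_le_right _ _).trans (min_le_left _ _),
      (mul_le_mul_right ((min_le_right _ _).trans (min_le_right _ _)) C).trans
        ENNReal.mul_div_le⟩
  obtain ⟨E, δ, hE, hEδ, hδ0, hδη, hδs⟩ := exists_cover_of_hausdorffMeasure_eq_zero hs hX hη0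
  choose 𝒞 hcov hdiam hcard using fun i => hbox (δ i) (hδ0 i) ((hδη i).trans hη1)
  have hediam (x : Σ i, 𝒞 i) : Metric.ediam (E x.1 ×ˢ (x.2 : Set Y)) ≤ δ x.1 :=
    Metric.ediam_le fun z hz w hw => max_le
      ((Metric.edist_le_ediam_of_mem hz.1 hw.1).trans (hEδ x.1))
      ((Metric.edist_le_ediam_of_mem hz.2 hw.2).trans (hdiam x.1 x.2 x.2.2))
  have hterm (i : ℕ) : (𝒞 i).card * δ i ^ (s + t) ≤ C * δ i ^ s := by
    have hδtop : δ i ≠ ∞ := ((hδη i).trans hη1).trans_lt ENNReal.one_lt_top |>.ne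
    rw [add_comm, ENNReal.rpow_add _ _ (hδ0 i).ne' hδtop, ← mul_assoc]
    gcongr
    exact hcard i
  refine ⟨Σ i, 𝒞 i, inferInstance, fun x => E x.1 ×ˢ (x.2 : Set Y), ?_,
    fun x => (hediam x).trans ((hδη x.1).trans hηε), ?_⟩
  · intro z _
    obtain ⟨i, hi⟩ := mem_iUnion.1 (hE (mem_univ z.1))
    obtain ⟨c, hc, hzc⟩ := mem_sUnion.1 ((hcov i).symm ▸ mem_univ z.2)
    exact mem_iUnion.2 ⟨⟨i, c, hc⟩, hi, hzc⟩
  · calc ∑' x : Σ i, 𝒞 i, Metric.ediam (E x.1 ×ˢ (x.2 : Set Y)) ^ (s + t)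
        ≤ ∑' x : Σ i, 𝒞 i, δ x.1 ^ (s + t) :=
          ENNReal.tsum_le_tsum fun x => ENNReal.rpow_le_rpow (hediam x) (by positivity)
      _ = ∑' i, (𝒞 i).card * δ i ^ (s + t) := by
          simp only [ENNReal.tsum_sigma' fun x : Σ i, 𝒞 i => δ x.1 ^ (s + t), tsum_fintype,
            Finset.sum_const, Finset.card_univ, Fintype.card_coe, nsmul_eq_mul]
      _ ≤ ∑' i, C * δ i ^ s := ENNReal.tsum_le_tsum hterm
      _ ≤ C * η := by
          rw [ENNReal.tsum_mul_left]
          gcongr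
      _ ≤ ε := hηC

theorem HasBoxCovers.dimH_prod_le (hY : HasBoxCovers Y t) :
    dimH (univ : Set (X × Y)) ≤ dimH (univ : Set X) + t := by
  borelize X
  borelize (X × Y)
  refine le_of_forall_gt_imp_ge_of_dense fun a ha => ?_
  obtain ⟨s, hXs, hsa⟩ := ENNReal.lt_iff_exists_nnreal_btwn.1 (lt_tsub_iff_right.2 ha)
  have hs : (0 : ℝ) < s := by exact_mod_cast pos_of_gt hXs
  have hmeas : μH[((s + t : ℝ≥0) : ℝ)] (univ : Set (X × Y)) = 0 :=
    hY.hausdorffMeasure_prod_eq_zero hs (hausdorffMeasure_of_dimH_lt hXs)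
  calc dimH (univ : Set (X × Y)) ≤ (s + t : ℝ≥0) :=
        dimH_le_of_hausdorffMeasure_ne_top (hmeas.trans_ne ENNReal.zero_ne_top)
    _ ≤ a := by
        rw [ENNReal.coe_add]
        exact add_le_of_le_tsub_right_of_le (le_add_self.trans ha.le) hsa.le

end Prod

theorem hausdorffDim_L2Prod_unitCube_le (X : Type*) [MetricSpace X] [Nonempty X] (k : ℕ) :
    hausdorffDim (L2Prod X (UnitCube k)) ≤ hausdorffDim X + (k : EReal) := by
  let g : X × (Fin k → Icc (0 : ℝ) 1) → L2Prod X (UnitCube k) :=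
    fun z => WithLp.toLp 2 (z.1, WithLp.toLp 2 z.2)
  have hg : LipschitzWith _ g := (WithLp.prod_lipschitzWith_toLp 2 X (UnitCube k)).comp
    (LipschitzWith.prod_fst.prodMk
      ((PiLp.lipschitzWith_toLp 2 fun _ : Fin k => Icc (0 : ℝ) 1).comp LipschitzWith.prod_snd))
  have hsurj : Function.Surjective g := fun z => ⟨(z.fst, WithLp.ofLp z.snd), rfl⟩
  have : Nonempty (L2Prod X (UnitCube k)) := ⟨g (Classical.arbitrary X, fun _ => 0)⟩
  have hcube : HasBoxCovers (Fin k → Icc (0 : ℝ) 1) k := by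
    simpa only [one_mul, Fintype.card_fin] using hasBoxCovers_unitInterval.pi (ι := Fin k)
  have hdim := hg.dimH_range_le.trans (hcube.dimH_prod_le (X := X))
  rw [hsurj.range_eq] at hdim
  rw [hausdorffDim_of_nonempty, hausdorffDim_of_nonempty]
  exact (EReal.coe_ennreal_le_coe_ennreal_iff.2 hdim).trans_eq (EReal.coe_ennreal_add _ _)

theorem image_fst_iInter_compl_eq_univ {X : Type*} [MetricSpace X] {k : ℕ}
    {U V : Fin k → Set (L2Prod X (UnitCube k))} (hU : ∀ i, IsOpen (U i)) (hV : ∀ i, IsOpen (V i))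
    (hUV : ∀ i, Disjoint (U i) (V i)) (h0 : ∀ i, {z | z.snd i = 0} ⊆ U i)
    (h1 : ∀ i, {z | z.snd i = 1} ⊆ V i) : WithLp.fst '' ⋂ i, (U i ∪ V i)ᶜ = (univ : Set X) := by
  refine eq_univ_of_forall fun x => ?_
  let ψ (y : Fin k → Icc (0 : ℝ) 1) : L2Prod X (UnitCube k) := WithLp.toLp 2 (x, WithLp.toLp 2 y)
  have hψ : Continuous ψ := (WithLp.prod_lipschitzWith_toLp 2 X (UnitCube k)).continuous.comp
    (continuous_const.prodMk (PiLp.continuous_toLp 2 _))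
  obtain ⟨y, hy⟩ := exists_forall_notMem_of_separate_faces (fun i => (hU i).preimage hψ)
    (fun i => (hV i).preimage hψ) (fun i => (hUV i).preimage ψ) (fun i y hy => h0 i hy)
    fun i y hy => h1 i hy
  exact ⟨ψ y, mem_iInter.2 hy, rfl⟩

theorem le_inductiveTopHausdorffDim_L2Prod_unitCube (X : Type*) [MetricSpace X]
    [SeparableSpace X] [Nonempty X] (k : ℕ) :
    hausdorffDim X + (k : EReal) ≤ inductiveTopHausdorffDim k (L2Prod X (UnitCube k)) := by
  have : SecondCountableTopology X := UniformSpace.secondCountable_of_separable X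
  refine le_of_forall_gt_imp_ge_of_dense fun d hd => ?_
  have hcoord (i : Fin k) : Continuous fun z : L2Prod X (UnitCube k) => z.snd i :=
    (PiLp.continuous_apply 2 _ i).comp
      (WithLp.prod_lipschitzWith_ofLp 2 X (UnitCube k)).continuous.snd
  obtain ⟨U, V, hU, hV, hUV, h0, h1, hdim⟩ := exists_separators_of_inductiveTopHausdorffDim_lt hd
    (fun i => isClosed_eq (hcoord i) (continuous_const (y := (0 : Icc (0 : ℝ) 1))))
    (fun i => isClosed_eq (hcoord i) (continuous_const (y := (1 : Icc (0 : ℝ) 1))))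
    fun i => disjoint_left.2 fun z h0 h1 => zero_ne_one (h0.symm.trans h1)
  have himage := image_fst_iInter_compl_eq_univ hU hV hUV h0 h1
  have hfst : LipschitzWith 1 fun z : L2Prod X (UnitCube k) => z.fst :=
    LipschitzWith.mk_one fun z w => WithLp.dist_fst_le z w
  refine le_trans ?_ (hdim (image_nonempty.1 (himage ▸ univ_nonempty)))
  rw [hausdorffDim_of_nonempty, ← himage]
  gcongr
  exact EReal.coe_ennreal_le_coe_ennreal_iff.2 (hfst.dimH_image_le _)

theorem lemma5p2 {X : Type*} [MetricSpace X] [TopologicalSpace.SeparableSpace X] [Nonempty X]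
    (n k : ℕ) (hnk : n ≤ k) :
    inductiveTopHausdorffDim n (L2Prod X (UnitCube k)) = hausdorffDim (L2Prod X (UnitCube k)) ∧
      hausdorffDim (L2Prod X (UnitCube k)) = hausdorffDim X + (k : EReal) := by
  have hlower := le_inductiveTopHausdorffDim_L2Prod_unitCube X k
  have hkn := inductiveTopHausdorffDim_antitone (L2Prod X (UnitCube k)) hnk
  have hn0 : inductiveTopHausdorffDim n (L2Prod X (UnitCube k)) ≤
      hausdorffDim (L2Prod X (UnitCube k)) :=
    inductiveTopHausdorffDim_antitone (L2Prod X (UnitCube k)) n.zero_le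
  have hupper := hausdorffDim_L2Prod_unitCube_le X k
  exact ⟨le_antisymm hn0 (hupper.trans (hlower.trans hkn)),
    le_antisymm hupper (hlower.trans (hkn.trans hn0))⟩
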